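/- Let $p$ be a prime, $K=\mathbb Z/p$, and let $c=2$ if $p$ is odd and $c=1$ if $p=2$. Let $F$ be the free graded associative $K$-algebra on generators $f^i$ ($i\ge 0$) and, for $p$ odd, $\beta f^i$ ($i>0$), with $|f^i|=c(p-1)i$ and $|\beta f^i|=2(p-1)i-1$, and with the coproduct (an algebra map into the graded tensor product) $\psi f^i=\sum_j f^{i-j}\otimes f^j$, $\psi \beta f^i=\sum_j \beta f^{i-j}\otimes f^j+\sum_j f^{i-j}\otimes\beta f^j$ (where $\beta f^0=0$). The excess of a monomial $\beta^{\epsilon_1}f^{i_1}\cdots\beta^{\epsilon_n}f^{i_n}$ with $n\ge 1$ is $c\,i_1-\epsilon_1-|\beta^{\epsilon_2}f^{i_2}\cdots\beta^{\epsilon_n}f^{i_n}|$. Let $T$ be the quotient of $F$ by the two-sided ideal generated by the monomials of negative excess, with the induced coproduct, and write $e^i$, $\beta e^i$ for the images of the generators. The monomials all of whose final segments have non-negative excess form a basis of $T$. Let $R$ be the Dyer-Lashof algebra, i.e. the quotient of $T$ by the two-sided ideal generated by the Adem relations: for $\epsilon\in\{0,1\}$ ($\epsilon=0$ if $p=2$),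 $$\beta^\epsilon e^a e^b=\sum_j(-1)^{a+j}\binom{(p-1)(j-b)-1}{pj-a}\beta^\epsilon e^{a+b-j}e^j\qquad(a>pb),$$ and for $p$ odd, $b>0$ and $a\ge pb$, $$\beta^\epsilon e^a\beta e^b=(1-\epsilon)\sum_j(-1)^{a+j}\binom{(p-1)(j-b)}{pj-a}\beta e^{a+b-j}e^j-\sum_j(-1)^{a+j}\binom{(p-1)(j-b)-1}{pj-a-1}\beta^\epsilon e^{a+b-j}\beta e^j,$$ where $\binom{m}{k}=0$ unless $0\le k\le m$. Let $T[n]$ and $R[n]$ be the spans of the monomials of length $n$ in $T$ and in $R$, and let $\rho:T[n]\to R[n]$ be the quotient map. The lower notation is defined by $f^ix=f_{i-|x|/c}\,x$. Give $T[n]^*$ the product dual to the coproduct. For $1\le t\le n$ let $h_t\in T[n]^*$ be the hom-dual, with respect to the monomial basis of $T[n]$, of the monomial $e_0\cdots e_0e_1e_0\cdots e_0$ (lower notation, $e_1$ at position $t$). Its degree is $|h_t|=c\,p^{t-1}(p-1)$. For $J=(j_1,\dots,j_n)\in\mathbb N^n$ put $h^J=h_1^{j_1}\cdots h_n^{j_n}$.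 Let $1\le i\le n$ and let $h^J$ be a monomial of degree $c\,(p^n-p^{n-i})$ which is not one of the summands of the expansion of the Dickson invariant $$d_{n,n-i}=\sum_{1\le j_1<\cdots<j_i\le n}\ \prod_{s=1}^{i}h_{j_s}^{\,p^{\,n-i+s-j_s}}.$$ Let $e_I$ be the monomial basis element of $T[n]$ which is hom-dual to $h^J$, i.e. $(e_I)^*=h^J$. Then $\rho(e_I)=0$ in $R[n]$. -/

import Mathlib

open scoped TensorProduct

namespace DyerLashof

noncomputable section

/- **Generators and words.** -/

/-- The grading factor: `|f^i| = 2(p-1)i` for odd `p`, and `|f^i| = i` for `p = 2`. -/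
def degFactor (p : ℕ) : ℕ := if p = 2 then 1 else 2

/-- The generators of the free algebra `F`: `f^i` for `i ≥ 0` (`bock = false`, `idx = i`) and,
for odd `p` only, `β f^i` for `i > 0` (`bock = true`, `idx = i`). -/
@[ext]
structure Gen (p : ℕ) where
  bock : Bool
  idx : ℕ
  ok : bock = true → p ≠ 2 ∧ 0 < idx

/-- The number of Bocksteins (`0` or `1`) in a generator. -/
def Gen.eps {p : ℕ} (g : Gen p) : ℤ := if g.bock = true then 1 else 0

/-- The degree of a generator. -/
def Gen.deg {p : ℕ} (g : Gen p) : ℤ := degFactor p * ((p : ℤ) - 1) * g.idx - g.eps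

/-- The generator `f^i`. -/
def Gen.f (p i : ℕ) : Gen p := ⟨false, i, fun h => by cases h⟩

/-- The degree of the monomial `f^{I,ε}`, given as a word in the generators. -/
def deg {p : ℕ} (w : List (Gen p)) : ℤ := (w.map Gen.deg).sum

/-- The excess of a monomial `f^{I,ε}`: it is `2 i₁ - ε₁ - |f^{I₂}|` (for `p = 2`: `i₁ - |f^{I₂}|`),
where `I₂` is the sequence without its first entry, and `∞` for the empty sequence. -/
def exc {p : ℕ} : List (Gen p) → WithTop ℤ
  | [] => ⊤
  | g :: w => ((degFactor p * (g.idx : ℤ) - g.eps - deg w : ℤ) : WithTop ℤ)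

/-- `f^{I,ε}` has non-negative excess: all final segments of `(I,ε)` have non-negative excess. -/
def NonnegExc {p : ℕ} (w : List (Gen p)) : Prop := ∀ v, v <:+ w → 0 ≤ exc v

/- **The algebras `F`, `T` and `R`.** -/

/-- The free associative algebra over `ℤ/p` on the `f^i` and `β f^i`. -/
abbrev F (p : ℕ) : Type := FreeAlgebra (ZMod p) (Gen p)

/-- The monomial `f^{I,ε}` in `F`. -/
def word {p : ℕ} (w : List (Gen p)) : F p := (w.map (FreeAlgebra.ι (ZMod p))).prod

/-- The element `f^i` (for `b = false`) or `β f^i` (for `b = true`) of `F`; here `β f^0 = 0`, and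
there are no Bocksteins for `p = 2`. -/
def gen (p : ℕ) (b : Bool) (i : ℕ) : F p :=
  open Classical in
  if h : b = true → p ≠ 2 ∧ 0 < i then FreeAlgebra.ι (ZMod p) ⟨b, i, h⟩ else 0

/-- The relations `f^{I,ε} = 0` for monomials of negative excess. -/
inductive ExcRel (p : ℕ) : F p → F p → Prop
  | of (w : List (Gen p)) (hw : exc w < 0) : ExcRel p (word w) 0

/-- `T = F / I_exc`. -/
abbrev T (p : ℕ) : Type := RingQuot (ExcRel p)

/-- The projection `F → T`. -/
def toT (p : ℕ) : F p →ₐ[ZMod p] T p := RingQuot.mkAlgHom (ZMod p) (ExcRel p)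

/-- The monomial `e_{I,ε}`, the image of `f^{I,ε}` in `T`. -/
def e {p : ℕ} (w : List (Gen p)) : T p := toT p (word w)

/-- The element `e^i` (for `b = false`) or `β e^i` (for `b = true`) of `T`. -/
def eGen (p : ℕ) (b : Bool) (i : ℕ) : T p := toT p (gen p b i)

/-- The Adem relations in upper notation (in lower notation `e_r e_s = e^a e^b` with `b = s` and
`a = r + (p-1)s`), together with the ones obtained by applying `β` on the left (`ε = true`).
Binomial coefficients with a negative entry are `0`; the sums therefore run over those `j` for
which none occurs. -/
inductive AdemRel (p : ℕ) : T p → T p → Prop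
  | adem (ε : Bool) (a b : ℕ) (h : p * b < a) :
      AdemRel p (eGen p ε a * eGen p false b)
        (∑ j ∈ Finset.range (a + b + 1) with a ≤ p * j ∧ (p - 1) * b + j < a,
          ((-1) ^ (a + j) * (((p - 1) * (j - b) - 1).choose (p * j - a) : ZMod p)) •
            (eGen p ε (a + b - j) * eGen p false j))
  | adem_bock (hp : p ≠ 2) (ε : Bool) (a b : ℕ) (hb : 0 < b) (h : p * b ≤ a) :
      AdemRel p (eGen p ε a * eGen p true b)
        ((if ε = true then 0 else
          ∑ j ∈ Finset.range (a + b + 1) with a ≤ p * j ∧ (p - 1) * b + j ≤ a,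
            ((-1) ^ (a + j) * (((p - 1) * (j - b)).choose (p * j - a) : ZMod p)) •
              (eGen p true (a + b - j) * eGen p false j))
        - ∑ j ∈ Finset.range (a + b + 1) with a < p * j ∧ (p - 1) * b + j ≤ a,
            ((-1) ^ (a + j) * (((p - 1) * (j - b) - 1).choose (p * j - a - 1) : ZMod p)) •
              (eGen p ε (a + b - j) * eGen p true j))

/-- The Dyer-Lashof algebra `R = T / I_Adem`. -/
abbrev R (p : ℕ) : Type := RingQuot (AdemRel p)

/-- The map `ρ : T → R` which imposes the Adem relations. -/
def rho (p : ℕ) : T p →ₐ[ZMod p] R p := RingQuot.mkAlgHom (ZMod p) (AdemRel p)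

/-- `T[n]`, the span of the monomials of length `n` in `T`. -/
def TN (p n : ℕ) : Submodule (ZMod p) (T p) :=
  Submodule.span (ZMod p) {x | ∃ w : List (Gen p), w.length = n ∧ x = e w}

/-- `R[n]`, the span of the monomials of length `n` in `R`. -/
def RN (p n : ℕ) : Submodule (ZMod p) (R p) :=
  Submodule.span (ZMod p) {x | ∃ w : List (Gen p), w.length = n ∧ x = rho p (e w)}

theorem rho_mem_RN {p n : ℕ} (x : T p) (hx : x ∈ TN p n) : rho p x ∈ RN p n := by
  induction hx using Submodule.span_induction with
  | mem x h => obtain ⟨w, hw, rfl⟩ := h; exact Submodule.subset_span ⟨w, hw, rfl⟩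
  | zero => simp
  | add x y _ _ hx hy => rw [map_add]; exact add_mem hx hy
  | smul a x _ hx => rw [map_smul]; exact Submodule.smul_mem _ _ hx

/-- The restriction `ρ : T[n] → R[n]`. -/
def rhoN (p n : ℕ) : TN p n →ₗ[ZMod p] RN p n :=
  (rho p).toLinearMap.restrict fun x hx => rho_mem_RN x hx

/-- The monomial `e_{I,ε}` of length `n` as an element of `T[n]`. -/
def eN {p n : ℕ} (w : List (Gen p)) (hw : w.length = n) : TN p n :=
  ⟨e w, Submodule.subset_span ⟨w, hw, rfl⟩⟩

/- **The dual basis of the monomial basis of `T`.** -/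

theorem word_nil {p : ℕ} : (word [] : F p) = 1 := rfl

theorem word_cons {p : ℕ} (g : Gen p) (w : List (Gen p)) :
    word (g :: w) = FreeAlgebra.ι (ZMod p) g * word w := by simp [word]

theorem word_append {p : ℕ} (u v : List (Gen p)) : word (u ++ v) = word u * word v := by
  simp [word]

theorem e_eq_zero {p : ℕ} {w : List (Gen p)} (hw : exc w < 0) : e w = 0 := by
  have := RingQuot.mkAlgHom_rel (ZMod p) (ExcRel.of w hw)
  simpa [e, toT] using this

theorem Gen.deg_nonneg {p : ℕ} [hp : Fact p.Prime] (g : Gen p) : 0 ≤ g.deg := by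
  obtain ⟨b, i, h⟩ := g
  have h2 : (2 : ℤ) ≤ p := by exact_mod_cast hp.out.two_le
  cases b with
  | false =>
    simp only [Gen.deg, Gen.eps, Bool.false_eq_true, if_false, sub_zero]
    have : (0 : ℤ) ≤ (p : ℤ) - 1 := by linarith
    positivity
  | true =>
    obtain ⟨hp2, hi⟩ := h rfl
    have hi' : (1 : ℤ) ≤ i := by exact_mod_cast hi
    simp only [Gen.deg, Gen.eps, if_true, degFactor, if_neg hp2]
    push_cast
    nlinarith

theorem deg_nonneg {p : ℕ} [Fact p.Prime] (w : List (Gen p)) : 0 ≤ deg w := by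
  apply List.sum_nonneg
  intro x hx
  obtain ⟨g, -, rfl⟩ := List.mem_map.1 hx
  exact g.deg_nonneg

theorem deg_append {p : ℕ} (u v : List (Gen p)) : deg (u ++ v) = deg u + deg v := by
  simp [deg]

theorem exc_append_neg {p : ℕ} [Fact p.Prime] {u : List (Gen p)} (hu : exc u < 0)
    (v : List (Gen p)) : exc (u ++ v) < 0 := by
  cases u with
  | nil => simp [exc] at hu
  | cons g u =>
    have hv := deg_nonneg v
    simp only [exc, List.cons_append, deg_append] at hu ⊢
    have hu' := WithTop.coe_lt_coe.1 (hu.trans_eq (WithTop.coe_zero (α := ℤ)).symm)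
    refine (WithTop.coe_lt_coe.2 ?_).trans_eq (WithTop.coe_zero (α := ℤ))
    linarith

/-- Left multiplication by a generator on monomials, where the monomials which are not of
non-negative excess are set to zero. -/
def actGen {p : ℕ} (g : Gen p) : (List (Gen p) →₀ ZMod p) →ₗ[ZMod p] (List (Gen p) →₀ ZMod p) :=
  open Classical in
  Finsupp.linearCombination (ZMod p)
    (fun w => if NonnegExc (g :: w) then Finsupp.single (g :: w) 1 else 0)

/-- The resulting action of `F` on the span of the monomials. -/
def actF (p : ℕ) : F p →ₐ[ZMod p] Module.End (ZMod p) (List (Gen p) →₀ ZMod p) :=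
  FreeAlgebra.lift (ZMod p) actGen

open Classical in
theorem actF_word_single {p : ℕ} (u : List (Gen p)) (hu : u ≠ []) (v : List (Gen p)) :
    actF p (word u) (Finsupp.single v 1) =
      if NonnegExc (u ++ v) then Finsupp.single (u ++ v) 1 else 0 := by
  induction u with
  | nil => exact absurd rfl hu
  | cons g u ih =>
    have hg : ∀ x, actF p (FreeAlgebra.ι (ZMod p) g) (Finsupp.single x 1) =
        if NonnegExc (g :: x) then Finsupp.single (g :: x) 1 else 0 := by
      intro x
      simp [actF, actGen]
    rw [word_cons, map_mul, Module.End.mul_apply]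
    by_cases hu' : u = []
    · subst hu'
      rw [word_nil, map_one, Module.End.one_apply, hg]
      rfl
    · rw [ih hu']
      by_cases h : NonnegExc (u ++ v)
      · rw [if_pos h, hg]; rfl
      · have h' : ¬ NonnegExc (g :: u ++ v) := fun hh => h fun x hx =>
          hh x (hx.trans (List.suffix_cons g (u ++ v)))
        rw [if_neg h, if_neg h', map_zero]

theorem actF_rel {p : ℕ} [Fact p.Prime] ⦃x y : F p⦄ (h : ExcRel p x y) :
    actF p x = actF p y := by
  classical
  obtain ⟨w, hw⟩ := h
  rw [map_zero]
  refine Finsupp.lhom_ext' fun v => LinearMap.ext_ring ?_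
  have hne : w ≠ [] := by rintro rfl; simp [exc] at hw
  simp only [LinearMap.comp_apply, Finsupp.lsingle_apply, LinearMap.zero_apply]
  rw [actF_word_single w hne, if_neg]
  exact fun h => absurd (h _ (List.suffix_refl _)) (not_le.2 (exc_append_neg hw v))

/-- The induced action of `T`. -/
def actT (p : ℕ) [Fact p.Prime] :
    T p →ₐ[ZMod p] Module.End (ZMod p) (List (Gen p) →₀ ZMod p) :=
  RingQuot.liftAlgHom (ZMod p) ⟨actF p, actF_rel⟩

/-- The hom-dual `(e_{I,ε})^*` of a monomial of non-negative excess: the linear functional which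
takes an element of `T` to the coefficient of `e_{I,ε}` in it, with respect to the basis of the
monomials of non-negative excess. The dual `T[n]^*` is the space of those functionals on `T` which
vanish on the monomials of length other than `n`. -/
def homDual {p : ℕ} [Fact p.Prime] (w : List (Gen p)) : Module.Dual (ZMod p) (T p) :=
  Finsupp.lapply w ∘ₗ LinearMap.applyₗ (Finsupp.single [] 1) ∘ₗ (actT p).toLinearMap

open Classical in
/-- `homDual` is the dual basis of the monomials of non-negative excess. -/
theorem homDual_e {p : ℕ} [Fact p.Prime] (w v : List (Gen p)) (hv : NonnegExc v) :
    homDual w (e v) = if w = v then 1 else 0 := by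
  have h : actT p (e v) = actF p (word v) := by
    simp [actT, e, toT]
  have h2 : actF p (word v) (Finsupp.single [] 1) = Finsupp.single v 1 := by
    by_cases hne : v = []
    · subst hne; simp [word_nil]
    · rw [actF_word_single v hne, List.append_nil, if_pos hv]
  simp only [homDual, LinearMap.comp_apply, AlgHom.toLinearMap_apply, LinearMap.applyₗ_apply_apply,
    h, h2, Finsupp.lapply_apply, Finsupp.single_apply, eq_comm]

/- **The coproduct of `T` and the product of `T[n]^*`.** -/

/-- The sign involution `x ↦ (-1)^{|x|} x` of `F`, with values in `T`. -/
def sgnF (p : ℕ) : F p →ₐ[ZMod p] T p :=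
  FreeAlgebra.lift (ZMod p) fun g => (if g.bock = true then (-1 : ZMod p) else 1) • e [g]

theorem sgnF_word {p : ℕ} (w : List (Gen p)) : ∃ c : ZMod p, sgnF p (word w) = c • e w := by
  induction w with
  | nil => exact ⟨1, by simp [e, word_nil]⟩
  | cons g w ih =>
    obtain ⟨c, hc⟩ := ih
    refine ⟨(if g.bock = true then (-1 : ZMod p) else 1) * c, ?_⟩
    have : e (g :: w) = e [g] * e w := by simp [e, word_cons, word_nil]
    rw [word_cons, map_mul, hc, this, sgnF, FreeAlgebra.lift_ι_apply, smul_mul_smul_comm]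

theorem sgnF_rel {p : ℕ} ⦃x y : F p⦄ (h : ExcRel p x y) : sgnF p x = sgnF p y := by
  obtain ⟨w, hw⟩ := h
  obtain ⟨c, hc⟩ := sgnF_word w
  rw [hc, e_eq_zero hw, smul_zero, map_zero]

/-- The sign involution `x ↦ (-1)^{|x|} x` of `T`. -/
def sgn (p : ℕ) : T p →ₐ[ZMod p] T p := RingQuot.liftAlgHom (ZMod p) ⟨sgnF p, sgnF_rel⟩

/-- Left multiplication by `a ⊗ b` on `T ⊗ T` with the product
`(a ⊗ b)(c ⊗ d) = (-1)^{|b||c|} ac ⊗ bd` of graded algebras, for `b` of even degree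
(`odd = false`) or of odd degree (`odd = true`). -/
def mulTensor {p : ℕ} (odd : Bool) (a b : T p) : Module.End (ZMod p) (T p ⊗[ZMod p] T p) :=
  TensorProduct.map
    (LinearMap.mulLeft (ZMod p) a ∘ₗ (if odd = true then (sgn p).toLinearMap else LinearMap.id))
    (LinearMap.mulLeft (ZMod p) b)

/-- Left multiplication on `T ⊗ T` by the coproduct of a generator, where
`ψ f^i = ∑ f^{i-j} ⊗ f^j` and `ψ βf^i = ∑ βf^{i-j} ⊗ f^j + ∑ f^{i-j} ⊗ βf^j`. -/
def comulGen {p : ℕ} (g : Gen p) : Module.End (ZMod p) (T p ⊗[ZMod p] T p) :=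
  if g.bock = true then
    ∑ j ∈ Finset.range (g.idx + 1), mulTensor false (eGen p true (g.idx - j)) (eGen p false j) +
    ∑ j ∈ Finset.range (g.idx + 1), mulTensor true (eGen p false (g.idx - j)) (eGen p true j)
  else
    ∑ j ∈ Finset.range (g.idx + 1), mulTensor false (eGen p false (g.idx - j)) (eGen p false j)

/-- Left multiplication on `T ⊗ T` by the coproduct of an element of `F`. -/
def comulF (p : ℕ) : F p →ₐ[ZMod p] Module.End (ZMod p) (T p ⊗[ZMod p] T p) :=
  FreeAlgebra.lift (ZMod p) comulGen

/-- The operators `x ⊗ y ↦ e_U A(x) ⊗ e_V y` for which the degrees and the excesses of `U` and `V`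
add up to those of `w`. -/
def splitOps {p : ℕ} (w : List (Gen p)) : Set (Module.End (ZMod p) (T p ⊗[ZMod p] T p)) :=
  {M | ∃ (u v : List (Gen p)) (A : T p →ₗ[ZMod p] T p), deg u + deg v = deg w ∧
    exc u + exc v = exc w ∧
    M = TensorProduct.map (LinearMap.mulLeft (ZMod p) (e u) ∘ₗ A)
      (LinearMap.mulLeft (ZMod p) (e v))}

theorem sgn_e {p : ℕ} (w : List (Gen p)) : ∃ c : ZMod p, sgn p (e w) = c • e w := by
  obtain ⟨c, hc⟩ := sgnF_word w
  exact ⟨c, by rw [← hc]; simp [sgn, e, toT]⟩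

theorem mulTensor_mem {p : ℕ} (odd b₁ b₂ : Bool) (i₁ i₂ : ℕ) (g : Gen p) (w : List (Gen p))
    (hi : i₁ + i₂ = g.idx)
    (hb : ((if b₁ = true then 1 else 0) + (if b₂ = true then 1 else 0) : ℤ) = g.eps)
    (M : Module.End (ZMod p) (T p ⊗[ZMod p] T p)) (hM : M ∈ splitOps w) :
    mulTensor odd (eGen p b₁ i₁) (eGen p b₂ i₂) * M ∈
      Submodule.span (ZMod p) (splitOps (g :: w)) := by
  classical
  by_cases h₁ : b₁ = true → p ≠ 2 ∧ 0 < i₁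
  swap
  · have h0 : eGen p b₁ i₁ = 0 := by rw [eGen, gen, dif_neg h₁, map_zero]
    have : mulTensor odd (eGen p b₁ i₁) (eGen p b₂ i₂) = 0 := by
      ext x y; simp [mulTensor, h0]
    rw [this, zero_mul]; exact zero_mem _
  by_cases h₂ : b₂ = true → p ≠ 2 ∧ 0 < i₂
  swap
  · have h0 : eGen p b₂ i₂ = 0 := by rw [eGen, gen, dif_neg h₂, map_zero]
    have : mulTensor odd (eGen p b₁ i₁) (eGen p b₂ i₂) = 0 := by
      ext x y; simp [mulTensor, h0]
    rw [this, zero_mul]; exact zero_mem _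
  obtain ⟨u, v, A, hd, hx, rfl⟩ := hM
  obtain ⟨c, hc⟩ := sgn_e u
  have hi' : (i₁ : ℤ) + i₂ = g.idx := by exact_mod_cast hi
  have hg : ∀ (b : Bool) (i : ℕ) (h : b = true → p ≠ 2 ∧ 0 < i) (x : List (Gen p)),
      e (⟨b, i, h⟩ :: x) = eGen p b i * e x := by
    intro b i h x
    simp only [e, eGen, gen]
    rw [dif_pos h, word_cons, map_mul]
  refine Submodule.subset_span ⟨⟨b₁, i₁, h₁⟩ :: u, ⟨b₂, i₂, h₂⟩ :: v,
    (if odd = true then c • (sgn p).toLinearMap else LinearMap.id) ∘ₗ A, ?_, ?_, ?_⟩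
  · simp only [deg, List.map_cons, List.sum_cons, Gen.deg, Gen.eps] at hd hb ⊢
    linear_combination hd - hb + degFactor p * ((p : ℤ) - 1) * hi'
  · simp only [exc, ← WithTop.coe_add]
    congr 1
    simp only [Gen.eps] at hb ⊢
    linear_combination (degFactor p : ℤ) * hi' - hb - hd
  · ext x y
    cases odd <;> simp [mulTensor, hg, hc]

theorem comulF_word_mem {p : ℕ} (w : List (Gen p)) :
    comulF p (word w) ∈ Submodule.span (ZMod p) (splitOps w) := by
  induction w with
  | nil =>
    refine Submodule.subset_span ⟨[], [], LinearMap.id, by simp [deg], by simp [exc], ?_⟩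
    ext x y
    simp [word_nil, e]
  | cons g w ih =>
    rw [word_cons, map_mul]
    have key : ∀ M ∈ Submodule.span (ZMod p) (splitOps w),
        comulGen g * M ∈ Submodule.span (ZMod p) (splitOps (g :: w)) := by
      intro M hM
      induction hM using Submodule.span_induction with
      | mem M hM =>
        have hj : ∀ j ∈ Finset.range (g.idx + 1), g.idx - j + j = g.idx := fun j hj =>
          Nat.sub_add_cancel (Nat.lt_succ_iff.1 (Finset.mem_range.1 hj))
        by_cases hb : g.bock = true
        · rw [comulGen, if_pos hb, add_mul, Finset.sum_mul, Finset.sum_mul]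
          refine add_mem (Submodule.sum_mem _ fun j h => ?_) (Submodule.sum_mem _ fun j h => ?_) <;>
          exact mulTensor_mem _ _ _ _ _ g w (hj j h) (by simp [Gen.eps, hb]) M hM
        · rw [comulGen, if_neg hb, Finset.sum_mul]
          exact Submodule.sum_mem _ fun j h =>
            mulTensor_mem _ _ _ _ _ g w (hj j h) (by simp [Gen.eps, hb]) M hM
      | zero => rw [mul_zero]; exact zero_mem _
      | add x y _ _ hx hy => rw [mul_add]; exact add_mem hx hy
      | smul a x _ hx => rw [mul_smul_comm]; exact Submodule.smul_mem _ _ hx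
    have := key _ ih
    rwa [show comulGen g = comulF p (FreeAlgebra.ι (ZMod p) g) by simp [comulF]] at this

theorem comulF_rel {p : ℕ} ⦃x y : F p⦄ (h : ExcRel p x y) : comulF p x = comulF p y := by
  obtain ⟨w, hw⟩ := h
  rw [map_zero, ← Submodule.mem_bot (ZMod p)]
  refine Submodule.span_le.2 ?_ (comulF_word_mem w)
  rintro M ⟨u, v, A, -, hx, rfl⟩
  rw [← hx] at hw
  have : exc u < 0 ∨ exc v < 0 := by
    by_contra hcon
    push Not at hcon
    exact absurd (add_nonneg hcon.1 hcon.2) (not_le.2 hw)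
  simp only [SetLike.mem_coe, Submodule.mem_bot]
  ext x y
  rcases this with h | h <;> simp [e_eq_zero h]

/-- The coproduct `ψ : T → T ⊗ T`: the homomorphism of graded algebras which is given on the
generators by `comulGen`. -/
def comul (p : ℕ) : T p →ₗ[ZMod p] T p ⊗[ZMod p] T p :=
  LinearMap.applyₗ (1 ⊗ₜ[ZMod p] 1) ∘ₗ
    (RingQuot.liftAlgHom (ZMod p) ⟨comulF p, comulF_rel⟩ :
      T p →ₐ[ZMod p] Module.End (ZMod p) (T p ⊗[ZMod p] T p)).toLinearMap

/-- The product of functionals on `T` which is dual to the coproduct,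
`⟨φχ, x⟩ = ⟨φ ⊗ χ, ψ x⟩`. -/
def dualMul {p : ℕ} (φ χ : Module.Dual (ZMod p) (T p)) : Module.Dual (ZMod p) (T p) :=
  LinearMap.mul' (ZMod p) (ZMod p) ∘ₗ TensorProduct.map φ χ ∘ₗ comul p

/- **The algebra `B[n]` and its identification with a subalgebra of `T[n]^*`.** -/

/-- The word of the monomial with lower notation `(i_1, …, i_n)` (without Bocksteins): since
`f^i x = f_{i - |x|/2} x` (for `p = 2`: `f^i x = f_{i - |x|} x`), the upper index is the lower one
plus `p - 1` times the sum of the upper indices to the right. -/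
def lowerWord (p : ℕ) : List ℕ → List (Gen p)
  | [] => []
  | i :: I => Gen.f p (i + (p - 1) * ((lowerWord p I).map Gen.idx).sum) :: lowerWord p I

/-- The monomial with lower notation `(0, …, 0, 1, 0, …, 0)`, where `1` is at position `t`. -/
def unitWord (p n : ℕ) (t : Fin n) : List (Gen p) :=
  lowerWord p (List.ofFn fun s : Fin n => if s = t then 1 else 0)

/-- The element of `T[n]^*` which corresponds to the generator `h_t` of `B[n]`, namely the hom-dual
of the monomial with lower notation `(0, …, 0, 1, 0, …, 0)`. -/
def hDual (p n : ℕ) [Fact p.Prime] (t : Fin n) : Module.Dual (ZMod p) (T p) :=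
  homDual (unitWord p n t)

/-- The unit of the algebra `T[n]^*`: the counit of `T[n]`, which is `1` on `(e^0)^n` and `0` on all
other monomials. -/
def dualOne (p n : ℕ) [Fact p.Prime] : Module.Dual (ZMod p) (T p) :=
  homDual (List.replicate n (Gen.f p 0))

/-- The element of `T[n]^*` which corresponds to the monomial `h^J = h_1^{j_1} ⋯ h_n^{j_n}` of
`B[n]`. -/
def hMonomial (p n : ℕ) [Fact p.Prime] (J : Fin n →₀ ℕ) : Module.Dual (ZMod p) (T p) :=
  (List.finRange n).foldr (fun t φ => (dualMul (hDual p n t))^[J t] φ) (dualOne p n)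

/-- The degree of `h^J`, where `|h_t| = 2 p^{t-1} (p-1)` (for `p = 2`: `2^{t-1}`),
`t = 1, …, n`. -/
def hDegree (p n : ℕ) (J : Fin n →₀ ℕ) : ℕ :=
  ∑ t : Fin n, J t * (degFactor p * p ^ (t : ℕ) * (p - 1))

/-- The expansion of the Dickson invariant `d_{n,n-i}` as a polynomial in `h_1, …, h_n`,
`∑_{1 ≤ j_1 < ⋯ < j_i ≤ n} ∏_{s=1}^{i} h_{j_s}^{p^{n-i+s-j_s}}`. Here indices start at `0`, which
does not change `s - j_s`; the exponents `n-i+s-j_s` are non-negative. -/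
def dicksonExpansion (p n i : ℕ) : MvPolynomial (Fin n) (ZMod p) :=
  open Classical in
  ∑ j : Fin i → Fin n with StrictMono j,
    ∏ s : Fin i, MvPolynomial.X (j s) ^ p ^ (n - i + (s : ℕ) - (j s : ℕ))

end

end DyerLashof

open DyerLashof

/-! The hypothesis on `I` is first made explicit: `I` must be the word whose lower notation is `J`.
The coproduct distributes upper indices additively, and the passage from lower to upper notation is
linear, so a product of functionals supported at lower sequences `A` and `B` can only be nonzero at
`A + B` (`SupportedAt.dualMul`). Hence `h^J` can only be nonzero on the monomial with lower notation
`J`, while the dual of `e_I` takes the value 1 on `e_I`.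

The Adem relation supplies the rest. Modulo negative excess, `e_r e_0` becomes `e_0 e_{r/p}` if `p ∣
r`, and 0 otherwise (`rho_e_lower_zero`). Suppose `ρ(e_J) ≠ 0` in the given degree. The degree
forces the last entry of `J` to be 0 or 1. A final 1 is removed, which lowers `n` and `i` by one. A
final 0 is moved to the front, which divides every other entry by `p` and lowers `n` alone. By
induction (`exists_strictMono_of_ne_zero`) `J` is the exponent of a Dickson summand, the chosen
indices being the places where a final 1 occurred. Distinct summands have distinct exponents, so
none cancels and `J` lies in the support, a contradiction. -/

namespace DyerLashof

/-! ### Monomials of `T` -/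

theorem e_nil {p : ℕ} : e ([] : List (Gen p)) = 1 := by simp [e, word_nil]

theorem e_append {p : ℕ} (u v : List (Gen p)) : e (u ++ v) = e u * e v := by
  simp [e, word_append]

theorem eGen_eq_e {p : ℕ} (b : Bool) (i : ℕ) (h : b = true → p ≠ 2 ∧ 0 < i) :
    eGen p b i = e [⟨b, i, h⟩] := by
  simp [eGen, gen, dif_pos h, e, word_cons, word_nil]

theorem eGen_eq_zero {p : ℕ} (b : Bool) (i : ℕ) (h : ¬ (b = true → p ≠ 2 ∧ 0 < i)) :
    eGen p b i = 0 := by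
  rw [eGen, gen, dif_neg h, map_zero]

theorem eGen_false {p : ℕ} (i : ℕ) : eGen p false i = e [Gen.f p i] :=
  eGen_eq_e false i _

theorem e_eq_zero_of_not_nonnegExc {p : ℕ} {v : List (Gen p)} (hv : ¬ NonnegExc v) :
    e v = 0 := by
  simp only [NonnegExc, not_forall, not_le] at hv
  obtain ⟨_, ⟨u, rfl⟩, hx⟩ := hv
  rw [e_append, e_eq_zero hx, mul_zero]

/-! ### Functionals supported at one monomial -/

/-- The functional `φ` vanishes on all monomials of `T` but possibly `e w`. -/
def SupportedAt {p : ℕ} (w : List (Gen p)) (φ : Module.Dual (ZMod p) (T p)) : Prop :=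
  ∀ v, φ (e v) ≠ 0 → v = w

/-- The test runs over all words, not only the basis; words outside the basis are zero in `T`. -/
theorem supportedAt_homDual {p : ℕ} [Fact p.Prime] (w : List (Gen p)) :
    SupportedAt w (homDual w) := by
  intro v hv
  by_cases h : NonnegExc v
  · rw [homDual_e w v h] at hv
    by_contra hne
    exact hv (if_neg fun h => hne h.symm)
  · rw [e_eq_zero_of_not_nonnegExc h, map_zero] at hv
    exact absurd rfl hv

/-! ### Splittings of a word and the support of a product -/

/-- The words `u` and `w` have the same length as `v`, the indices of the entries of `u` and `w`
add up to those of `v`, and `v` has a Bockstein only where `u` or `w` has one. -/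
inductive IsSplit {p : ℕ} : List (Gen p) → List (Gen p) → List (Gen p) → Prop
  | nil : IsSplit [] [] []
  | cons {a b g : Gen p} {u w v : List (Gen p)} (hidx : a.idx + b.idx = g.idx)
      (hbock : a.bock = false → b.bock = false → g.bock = false) (h : IsSplit u w v) :
      IsSplit (a :: u) (b :: w) (g :: v)

theorem IsSplit.sum_idx {p : ℕ} {u w v : List (Gen p)} (h : IsSplit u w v) :
    (u.map Gen.idx).sum + (w.map Gen.idx).sum = (v.map Gen.idx).sum := by
  induction h with
  | nil => rfl
  | cons hidx _ _ ih =>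
    simp only [List.map_cons, List.sum_cons]
    omega

/-- Each upper index is a linear function of the lower indices, so adding upper indices entrywise
adds lower ones. Neither factor has a Bockstein, hence neither does the word being split. -/
theorem IsSplit.eq_lowerWord {p : ℕ} : ∀ {A B : List ℕ} {v : List (Gen p)},
    IsSplit (lowerWord p A) (lowerWord p B) v → v = lowerWord p (List.zipWith (· + ·) A B)
  | [], [], _, .nil => rfl
  | a :: A, b :: B, g :: v, .cons hidx hbock h => by
    have hs := h.sum_idx
    have hv := h.eq_lowerWord
    rw [List.zipWith_cons_cons, lowerWord, ← hv]
    congr 1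
    refine Gen.ext (hbock rfl rfl) ?_
    rw [← hidx]
    simp only [Gen.f]
    rw [← hs, mul_add]
    ring

/-- The span of the tensors `e u ⊗ e w` for which `(u, w)` splits `v`. -/
def splitSpan {p : ℕ} (v : List (Gen p)) : Submodule (ZMod p) (T p ⊗[ZMod p] T p) :=
  Submodule.span (ZMod p) {x | ∃ u w, IsSplit u w v ∧ x = e u ⊗ₜ[ZMod p] e w}

theorem mulTensor_apply_mem_splitSpan {p : ℕ} (odd a b : Bool) (i j : ℕ) (g : Gen p)
    (hidx : i + j = g.idx) (hbock : a = false → b = false → g.bock = false)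
    (v : List (Gen p)) (x : T p ⊗[ZMod p] T p) (hx : x ∈ splitSpan v) :
    mulTensor odd (eGen p a i) (eGen p b j) x ∈ splitSpan (g :: v) := by
  induction hx using Submodule.span_induction with
  | zero => rw [map_zero]; exact zero_mem _
  | add x y _ _ hx hy => rw [map_add]; exact add_mem hx hy
  | smul c x _ hx => rw [map_smul]; exact Submodule.smul_mem _ _ hx
  | mem x hx =>
    obtain ⟨u, w, h, rfl⟩ := hx
    -- The Koszul sign only rescales a tensor of monomials, so its value is irrelevant to the span.
    have hodd : ∃ c : ZMod p, mulTensor odd (eGen p a i) (eGen p b j) (e u ⊗ₜ[ZMod p] e w) =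
        c • ((eGen p a i * e u) ⊗ₜ[ZMod p] (eGen p b j * e w)) := by
      cases odd with
      | false => exact ⟨1, by simp [mulTensor]⟩
      | true =>
        obtain ⟨c, hc⟩ := sgn_e u
        exact ⟨c, by simp [mulTensor, hc, TensorProduct.smul_tmul']⟩
    obtain ⟨c, hc⟩ := hodd
    rw [hc]
    apply Submodule.smul_mem
    by_cases ha : a = true → p ≠ 2 ∧ 0 < i
    swap
    · rw [eGen_eq_zero a i ha, zero_mul, TensorProduct.zero_tmul]; exact zero_mem _
    by_cases hb : b = true → p ≠ 2 ∧ 0 < j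
    swap
    · rw [eGen_eq_zero b j hb, zero_mul, TensorProduct.tmul_zero]; exact zero_mem _
    rw [eGen_eq_e a i ha, eGen_eq_e b j hb, ← e_append, ← e_append]
    exact Submodule.subset_span ⟨_, _, .cons hidx hbock h, rfl⟩

theorem comulF_word_apply_mem_splitSpan {p : ℕ} (v : List (Gen p)) :
    comulF p (word v) (1 ⊗ₜ[ZMod p] 1) ∈ splitSpan v := by
  induction v with
  | nil =>
    refine Submodule.subset_span ⟨[], [], .nil, ?_⟩
    simp [word_nil, e_nil]
  | cons g v ih =>
    have hg : comulF p (FreeAlgebra.ι (ZMod p) g) = comulGen g := by simp [comulF]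
    have hj : ∀ j ∈ Finset.range (g.idx + 1), g.idx - j + j = g.idx := fun j hj =>
      Nat.sub_add_cancel (Nat.lt_succ_iff.1 (Finset.mem_range.1 hj))
    rw [word_cons, map_mul, Module.End.mul_apply, hg]
    by_cases hb : g.bock = true
    · rw [comulGen, if_pos hb, LinearMap.add_apply, LinearMap.sum_apply, LinearMap.sum_apply]
      refine add_mem (Submodule.sum_mem _ fun j h => ?_) (Submodule.sum_mem _ fun j h => ?_)
      · exact mulTensor_apply_mem_splitSpan _ _ _ _ _ g (hj j h) (by simp) v _ ih
      · exact mulTensor_apply_mem_splitSpan _ _ _ _ _ g (hj j h) (by simp) v _ ih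
    · rw [comulGen, if_neg hb, LinearMap.sum_apply]
      exact Submodule.sum_mem _ fun j h =>
        mulTensor_apply_mem_splitSpan _ _ _ _ _ g (hj j h) (by simpa using hb) v _ ih

theorem comul_e_mem_splitSpan {p : ℕ} (v : List (Gen p)) : comul p (e v) ∈ splitSpan v := by
  have h : comul p (e v) = comulF p (word v) (1 ⊗ₜ[ZMod p] 1) := by
    simp [comul, e, toT]
  rw [h]
  exact comulF_word_apply_mem_splitSpan v

/-- Every tensor in the coproduct of `e v` comes from a splitting of `v`; a nonzero contribution
fixes both factors and therefore `v`. Only the support is tracked, no coefficient is computed. -/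
theorem SupportedAt.dualMul {p : ℕ} {A B : List ℕ} {φ χ : Module.Dual (ZMod p) (T p)}
    (hφ : SupportedAt (lowerWord p A) φ) (hχ : SupportedAt (lowerWord p B) χ) :
    SupportedAt (lowerWord p (List.zipWith (· + ·) A B)) (dualMul φ χ) := by
  intro v hv
  by_contra hne
  refine hv ?_
  have key : ∀ x ∈ splitSpan v,
      LinearMap.mul' (ZMod p) (ZMod p) (TensorProduct.map φ χ x) = 0 := by
    intro x hx
    induction hx using Submodule.span_induction with
    | zero => simp
    | add x y _ _ hx hy => rw [map_add, map_add, hx, hy, add_zero]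
    | smul c x _ hx => rw [map_smul, map_smul, hx, smul_zero]
    | mem x hx =>
      obtain ⟨u, w, h, rfl⟩ := hx
      rw [TensorProduct.map_tmul, LinearMap.mul'_apply]
      by_contra h0
      obtain ⟨h1, h2⟩ := ne_zero_and_ne_zero_of_mul h0
      rw [hφ u h1, hχ w h2] at h
      exact hne h.eq_lowerWord
  exact key _ (comul_e_mem_splitSpan v)

theorem zipWith_add_ofFn {n : ℕ} (a b : Fin n → ℕ) :
    List.zipWith (· + ·) (List.ofFn a) (List.ofFn b) = List.ofFn (a + b) := by
  apply List.ext_getElem <;> simp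

theorem lowerWord_replicate_zero (p n : ℕ) :
    lowerWord p (List.replicate n 0) = List.replicate n (Gen.f p 0) := by
  induction n with
  | zero => rfl
  | succ n ih => simp [List.replicate_succ, lowerWord, ih, Gen.f]

theorem supportedAt_dualOne (p n : ℕ) [Fact p.Prime] :
    SupportedAt (lowerWord p (List.ofFn (0 : Fin n → ℕ))) (dualOne p n) := by
  have h : List.ofFn (0 : Fin n → ℕ) = List.replicate n 0 := List.ofFn_const n 0
  rw [h, lowerWord_replicate_zero]
  exact supportedAt_homDual _

theorem supportedAt_iterate_dualMul {p n : ℕ} [Fact p.Prime] (t : Fin n) (m : ℕ) {a : Fin n → ℕ}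
    {φ : Module.Dual (ZMod p) (T p)} (hφ : SupportedAt (lowerWord p (List.ofFn a)) φ) :
    SupportedAt (lowerWord p (List.ofFn (Pi.single t m + a)))
      ((dualMul (hDual p n t))^[m] φ) := by
  induction m with
  | zero => simpa using hφ
  | succ m ih =>
    rw [Function.iterate_succ_apply']
    have h1 : SupportedAt (lowerWord p (List.ofFn (Pi.single t 1 : Fin n → ℕ))) (hDual p n t) := by
      have : (Pi.single t 1 : Fin n → ℕ) = fun s => if s = t then 1 else 0 := by
        ext s; simp [Pi.single_apply]
      rw [this]
      exact supportedAt_homDual _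
    have h2 := h1.dualMul ih
    rwa [zipWith_add_ofFn, ← add_assoc, ← Pi.single_add, add_comm 1 m] at h2

theorem supportedAt_hMonomial (p n : ℕ) [Fact p.Prime] (J : Fin n →₀ ℕ) :
    SupportedAt (lowerWord p (List.ofFn J)) (hMonomial p n J) := by
  have key : ∀ l : List (Fin n), SupportedAt
      (lowerWord p (List.ofFn (l.map fun t => (Pi.single t (J t) : Fin n → ℕ)).sum))
      (l.foldr (fun t φ => (dualMul (hDual p n t))^[J t] φ) (dualOne p n)) := by
    intro l
    induction l with
    | nil => exact supportedAt_dualOne p n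
    | cons t l ih => exact supportedAt_iterate_dualMul t (J t) ih
  have h := key (List.finRange n)
  have hs : ((List.finRange n).map fun t => (Pi.single t (J t) : Fin n → ℕ)).sum = J := by
    rw [← List.ofFn_eq_map, List.sum_ofFn]
    exact Finset.univ_sum_single _
  rwa [hs] at h

theorem eq_lowerWord_of_homDual_eq {p n : ℕ} [Fact p.Prime] {J : Fin n →₀ ℕ} {I : List (Gen p)}
    (hexc : NonnegExc I) (hdual : homDual I = hMonomial p n J) :
    I = lowerWord p (List.ofFn J) := by
  apply supportedAt_hMonomial p n J
  rw [← hdual, homDual_e I I hexc, if_pos rfl]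
  exact one_ne_zero

/-! ### The Adem relation for `e_r e_0` in lower notation -/

theorem deg_lowerWord (p : ℕ) (L : List ℕ) :
    deg (lowerWord p L) = degFactor p * ((p : ℤ) - 1) * ((lowerWord p L).map Gen.idx).sum := by
  induction L with
  | nil => simp [lowerWord, deg]
  | cons i L ih =>
    have h : deg (lowerWord p (i :: L)) =
        (Gen.f p (i + (p - 1) * ((lowerWord p L).map Gen.idx).sum)).deg + deg (lowerWord p L) := by
      simp [deg, lowerWord]
    rw [h, ih]
    simp only [lowerWord, List.map_cons, List.sum_cons, Gen.deg, Gen.eps, Gen.f]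
    push_cast
    simp
    ring

theorem degFactor_pos (p : ℕ) : 0 < degFactor p := by
  unfold degFactor; split <;> norm_num

/-- Fermat gives `(-1)^p = -1` in `ZMod p` for every prime, including 2. This is the sign of the
surviving Adem term. -/
theorem neg_one_pow_mul_add {p : ℕ} [Fact p.Prime] (j : ℕ) :
    (-1 : ZMod p) ^ (p * j + j) = 1 := by
  rw [pow_add, pow_mul, ZMod.pow_card, ← mul_pow]
  simp

/-- `e^a e^b x` vanishes in `T` if its excess is negative. -/
theorem e_f_mul_eq_zero {p : ℕ} (hp : 1 ≤ p) (a b q : ℕ) (X : List ℕ)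
    (hq : (p - 1) * ((lowerWord p X).map Gen.idx).sum = q) (h : a < (p - 1) * b + q) :
    e (Gen.f p a :: Gen.f p b :: lowerWord p X) = 0 := by
  apply e_eq_zero
  obtain ⟨m, rfl⟩ : ∃ m, p = m + 1 := ⟨p - 1, by omega⟩
  have hd := deg_lowerWord (m + 1) X
  have h1 : deg (Gen.f (m + 1) b :: lowerWord (m + 1) X) =
      (Gen.f (m + 1) b).deg + deg (lowerWord (m + 1) X) := by simp [deg]
  refine (WithTop.coe_lt_coe.2 ?_).trans_eq (WithTop.coe_zero (α := ℤ))
  rw [h1, hd]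
  have hc : (0 : ℤ) < degFactor (m + 1) := by exact_mod_cast degFactor_pos _
  simp only [Nat.add_sub_cancel] at hq h
  have h' : (a : ℤ) < m * b + q := by exact_mod_cast h
  have hq' : (m : ℤ) * (((lowerWord (m + 1) X).map Gen.idx).sum : ℕ) = q := by exact_mod_cast hq
  simp only [Gen.deg, Gen.eps, Gen.f, Bool.false_eq_true, if_false]
  push_cast at hq' ⊢
  have := mul_lt_mul_of_pos_left h' hc
  linear_combination this - (degFactor (m + 1) : ℤ) * hq'

theorem e_cons_cons {p : ℕ} (a b : ℕ) (w : List (Gen p)) :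
    e (Gen.f p a :: Gen.f p b :: w) = eGen p false a * eGen p false b * e w := by
  rw [eGen_false, eGen_false, ← e_append, ← e_append]
  rfl

/-- The Adem relation for `e_r e_0 x` in lower notation. -/
theorem rho_e_lower_zero (p : ℕ) [hp : Fact p.Prime] (r : ℕ) (X : List ℕ) :
    rho p (e (lowerWord p (r :: 0 :: X))) =
      if p ∣ r then rho p (e (lowerWord p (0 :: r / p :: X))) else 0 := by
  rcases Nat.eq_zero_or_pos r with rfl | hr
  · simp
  have hp1 : 1 < p := hp.out.one_lt
  obtain ⟨m, rfl⟩ : ∃ m, p = m + 1 := ⟨p - 1, by omega⟩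
  have hm : 0 < m := by omega
  obtain ⟨q, hq⟩ : ∃ q, (m + 1 - 1) * ((lowerWord (m + 1) X).map Gen.idx).sum = q := ⟨_, rfl⟩
  have hq' : m * ((lowerWord (m + 1) X).map Gen.idx).sum = q := hq
  have hw : lowerWord (m + 1) (r :: 0 :: X) =
      Gen.f (m + 1) (r + (m + 1) * q) :: Gen.f (m + 1) q :: lowerWord (m + 1) X := by
    simp only [lowerWord, Gen.f, List.map_cons, List.sum_cons, Nat.add_sub_cancel, mul_add, hq',
      zero_add]
    congr 2
    ring
  -- In upper notation `a = r + p q` and `b = q`, so `a > p b` amounts to `r > 0`.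
  have hrel := RingQuot.mkAlgHom_rel (ZMod (m + 1))
    (AdemRel.adem (p := m + 1) false (r + (m + 1) * q) q (by omega))
  rw [hw, e_cons_cons, map_mul]
  change rho (m + 1) _ = rho (m + 1) _ at hrel
  rw [hrel, ← map_mul, Finset.sum_mul]
  -- Because `b = q`, the excess of the `j`-th term is a positive multiple of `a - p j`. The sum
  -- only has `a ≤ p j`, so just `a = p j` can survive: this needs `p ∣ r` and `j = r / p + q`, and
  -- the binomial coefficient is then 1.
  by_cases hd : m + 1 ∣ r
  · obtain ⟨l, rfl⟩ := hd
    rw [if_pos (dvd_mul_right _ _), Nat.mul_div_cancel_left _ (Nat.succ_pos m)]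
    have hl : 0 < l := Nat.pos_of_mul_pos_left hr
    have hw2 : lowerWord (m + 1) (0 :: l :: X) =
        Gen.f (m + 1) (m * (l + q) + q) :: Gen.f (m + 1) (l + q) :: lowerWord (m + 1) X := by
      simp only [lowerWord, Gen.f, List.map_cons, List.sum_cons, Nat.add_sub_cancel, mul_add, hq']
      congr 2
      ring
    -- At `j = l + q` the bound `(p - 1) b + j < a` of the Adem sum reads `0 < m l`.
    have hml : 0 < m * l := Nat.mul_pos hm hl
    congr 1
    rw [Finset.sum_eq_single (l + q), hw2, e_cons_cons]
    · have h1 : (m + 1) * l + (m + 1) * q = (m + 1) * (l + q) := by ring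
      have h2 : (m + 1) * (l + q) + q - (l + q) = m * (l + q) + q := by
        rw [show (m + 1) * (l + q) + q = m * (l + q) + q + (l + q) by ring, Nat.add_sub_cancel]
      rw [h1, h2, Nat.sub_self, Nat.choose_zero_right, neg_one_pow_mul_add]
      simp
    · intro j hj hne
      simp only [Finset.mem_filter, Finset.mem_range] at hj
      obtain ⟨hj1, hj2, hj3⟩ := hj
      have hlt : l + q < j := by
        rcases lt_or_gt_of_ne hne with h | h
        · have := Nat.mul_lt_mul_of_pos_left h (Nat.succ_pos m)
          simp only [Nat.succ_eq_add_one] at this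
          rw [mul_add] at this
          omega
        · exact h
      have hlt' := Nat.mul_lt_mul_of_pos_left hlt (Nat.succ_pos m)
      simp only [Nat.succ_eq_add_one] at hlt'
      rw [mul_add, Nat.succ_mul m j] at hlt'
      rw [smul_mul_assoc, ← e_cons_cons, e_f_mul_eq_zero (by omega) _ _ q X hq, smul_zero]
      simp only [Nat.add_sub_cancel]
      omega
    · intro h
      exfalso
      apply h
      simp only [Finset.mem_filter, Finset.mem_range, Nat.add_sub_cancel, add_mul, one_mul, mul_add]
      omega
  · rw [if_neg hd]
    rw [Finset.sum_eq_zero, map_zero]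
    intro j hj
    simp only [Finset.mem_filter, Finset.mem_range] at hj
    obtain ⟨hj1, hj2, hj3⟩ := hj
    have hne : r + (m + 1) * q ≠ (m + 1) * j := fun h =>
      hd ((Nat.dvd_add_left (dvd_mul_right _ q)).1 (h ▸ dvd_mul_right _ j))
    have hlt : r + (m + 1) * q < (m + 1) * j := lt_of_le_of_ne hj2 hne
    rw [Nat.succ_mul m j] at hlt
    rw [smul_mul_assoc, ← e_cons_cons, e_f_mul_eq_zero (by omega) _ _ q X hq, smul_zero]
    simp only [Nat.add_sub_cancel]
    omega

/-- The upper indices of a prefix depend on the tail only through the sum of its upper indices.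
Relations between tails with equal sums can thus be multiplied on the left without disturbing the
lower notation. -/
theorem exists_lowerWord_append (p : ℕ) (A : List ℕ) (s : ℕ) :
    ∃ u : List (Gen p), ∀ X, ((lowerWord p X).map Gen.idx).sum = s →
      lowerWord p (A ++ X) = u ++ lowerWord p X := by
  induction A with
  | nil => exact ⟨[], fun X _ => rfl⟩
  | cons a A ih =>
    obtain ⟨u, hu⟩ := ih
    refine ⟨Gen.f p (a + (p - 1) * ((u.map Gen.idx).sum + s)) :: u, fun X hX => ?_⟩
    simp only [List.cons_append, lowerWord, hu X hX, List.map_append, List.sum_append, hX]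

theorem rho_e_lower_append_zero (p : ℕ) [hp : Fact p.Prime] (A : List ℕ) (r : ℕ) (X : List ℕ) :
    rho p (e (lowerWord p (A ++ r :: 0 :: X))) =
      if p ∣ r then rho p (e (lowerWord p (A ++ 0 :: r / p :: X))) else 0 := by
  obtain ⟨u, hu⟩ := exists_lowerWord_append p A
    ((lowerWord p (r :: 0 :: X)).map Gen.idx).sum
  rw [hu _ rfl, e_append, map_mul, rho_e_lower_zero]
  split_ifs with h
  · rw [hu, e_append, map_mul]
    -- What remains is that both tails have the same sum of upper indices, as Adem relations
    -- preserve it.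
    obtain ⟨l, rfl⟩ := h
    obtain ⟨m, rfl⟩ : ∃ m, p = m + 1 := ⟨p - 1, by have := hp.out.one_lt; omega⟩
    rw [Nat.mul_div_cancel_left _ (Nat.succ_pos m)]
    simp only [lowerWord, Gen.f, List.map_cons, List.sum_cons, Nat.add_sub_cancel]
    ring
  · rw [mul_zero]

/-! ### Monomials of the degree of a Dickson invariant -/

section Combinatorics

variable {M : Type*} [Zero M] {p : ℕ} {E : List ℕ → M}

/-- The 0 passes the entries of `L` from right to left, each passage dividing one entry by `p`;
nonvanishing forces the divisibility. Entries already passed join `X`, so `X` varies in the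
induction. -/
theorem dvd_and_ne_zero_of_append_zero
    (hE : ∀ A r X, E (A ++ r :: 0 :: X) = if p ∣ r then E (A ++ 0 :: r / p :: X) else 0)
    (A L X : List ℕ) (h : E (A ++ (L ++ 0 :: X)) ≠ 0) :
    (∀ x ∈ L, p ∣ x) ∧ E ((A ++ [0]) ++ (L.map (· / p) ++ X)) ≠ 0 := by
  induction L using List.reverseRecOn generalizing X with
  | nil => simpa using h
  | append_singleton L x ih =>
    have h1 := hE (A ++ L) x X
    rw [show A ++ L ++ x :: 0 :: X = A ++ (L ++ [x] ++ 0 :: X) by simp] at h1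
    rw [h1] at h
    obtain ⟨hx, h2⟩ := ite_ne_right_iff.1 h
    obtain ⟨h3, h4⟩ := ih (x / p :: X) (by simpa using h2)
    refine ⟨?_, by simpa using h4⟩
    intro y hy
    rcases List.mem_append.1 hy with hy | hy
    · exact h3 y hy
    · rwa [List.mem_singleton.1 hy]

/-- A sequence of the degree of the Dickson invariant `d_{n,n-i}` on which `E` does not vanish in
every context is the exponent sequence of a summand of its expansion. -/
theorem exists_strictMono_of_ne_zero (hp : 2 ≤ p)
    (hE : ∀ A r X, E (A ++ r :: 0 :: X) = if p ∣ r then E (A ++ 0 :: r / p :: X) else 0)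
    (n : ℕ) : ∀ (i : ℕ) (_ : i ≤ n) (J : Fin n → ℕ)
    (_ : (∑ t : Fin n, J t * p ^ (t : ℕ)) * (p - 1) + p ^ (n - i) = p ^ n) (A X : List ℕ)
    (_ : E (A ++ (List.ofFn J ++ X)) ≠ 0),
    ∃ j : Fin i → ℕ, StrictMono j ∧ (∀ s, j s < n) ∧ (∀ s, j s ≤ n - i + s) ∧
      ∀ t : Fin n, J t = ∑ s : Fin i, if j s = t then p ^ (n - i + s - j s) else 0 := by
  -- The contexts stay arbitrary: a final 1 is moved into `X`, a 0 brought to the front into `A`.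
  induction n with
  | zero =>
    intro i hi J _ A X _
    obtain rfl : i = 0 := by omega
    exact ⟨Fin.elim0, fun s => s.elim0, fun s => s.elim0, fun s => s.elim0, fun t => t.elim0⟩
  | succ n ih =>
    intro i hi J hdeg A X hne
    obtain ⟨m, rfl⟩ : ∃ m, p = m + 1 := ⟨p - 1, by omega⟩
    rw [Nat.add_sub_cancel] at hdeg ih
    rw [List.ofFn_succ', List.concat_eq_append] at hne
    rw [Fin.sum_univ_castSucc] at hdeg
    simp only [Fin.val_castSucc, Fin.val_last] at hdeg
    have hpos : 0 < (m + 1) ^ (n + 1 - i) := by positivity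
    have hposn : 0 < (m + 1) ^ n := by positivity
    -- Two copies of the top weight already contribute `2 p^n (p - 1) ≥ p^(n+1)`, which leaves no
    -- room for the positive term `p^(n+1-i)`.
    have hlast : J (Fin.last n) ≤ 1 := by
      by_contra hcon
      have h2 : 2 ≤ J (Fin.last n) := by omega
      have h3 : 2 * (m + 1) ^ n * m ≤ J (Fin.last n) * (m + 1) ^ n * m := by gcongr
      have h4 : (m + 1) ^ n * 1 ≤ (m + 1) ^ n * m := by gcongr; omega
      have h5 := Nat.zero_le ((∑ t : Fin n, J t.castSucc * (m + 1) ^ (t : ℕ)) * m)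
      rw [add_mul, pow_succ] at hdeg
      linarith
    rcases Nat.le_one_iff_eq_zero_or_eq_one.1 hlast with h0 | h1
    · rw [h0, zero_mul, add_zero] at hdeg
      rw [h0, List.append_assoc, List.singleton_append] at hne
      obtain ⟨hdvd, hne'⟩ := dvd_and_ne_zero_of_append_zero hE _ _ _ hne
      have hdvd' : ∀ t : Fin n, m + 1 ∣ J t.castSucc := fun t =>
        hdvd _ (List.mem_ofFn.2 ⟨t, rfl⟩)
      choose K hK using hdvd'
      have hmap : (List.ofFn fun t : Fin n => J t.castSucc).map (· / (m + 1)) = List.ofFn K := by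
        rw [List.map_ofFn]
        congr 1
        ext t
        simp only [Function.comp, hK, Nat.mul_div_cancel_left _ (Nat.succ_pos m)]
      rw [hmap] at hne'
      have hsum : ∑ t : Fin n, J t.castSucc * (m + 1) ^ (t : ℕ) =
          (m + 1) * ∑ t : Fin n, K t * (m + 1) ^ (t : ℕ) := by
        rw [Finset.mul_sum]
        exact Finset.sum_congr rfl fun t _ => by rw [hK, mul_assoc]
      rw [hsum] at hdeg
      -- For `i = n + 1` the degree equation would read `0 + 1 = 0` modulo `p`.
      have hin : i ≤ n := by
        by_contra hcon
        obtain rfl : i = n + 1 := by omega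
        rw [Nat.sub_self, pow_zero, mul_assoc, pow_succ', add_comm] at hdeg
        have := (Nat.dvd_add_left (dvd_mul_right _ _)).1 (hdeg ▸ dvd_mul_right (m + 1) _)
        rw [Nat.dvd_one] at this
        omega
      have hdeg' : (∑ t : Fin n, K t * (m + 1) ^ (t : ℕ)) * m + (m + 1) ^ (n - i) =
          (m + 1) ^ n := by
        rw [Nat.sub_add_comm hin, pow_succ', pow_succ', mul_assoc, ← mul_add] at hdeg
        exact Nat.eq_of_mul_eq_mul_left (Nat.succ_pos m) hdeg
      obtain ⟨j, hj1, hj2, hj3, hj4⟩ := ih i hin K hdeg' _ _ hne'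
      refine ⟨j, hj1, fun s => (hj2 s).trans (Nat.lt_succ_self n),
        fun s => by have := hj3 s; omega, fun t => ?_⟩
      induction t using Fin.lastCases with
      | last =>
        rw [h0, eq_comm]
        exact Finset.sum_eq_zero fun s _ => if_neg (by have := hj2 s; simp; omega)
      | cast t =>
        rw [hK, hj4, Finset.mul_sum]
        refine Finset.sum_congr rfl fun s _ => ?_
        -- This bound rules out truncation, so raising `n` by one raises the exponent of `p` by one,
        -- matching the factor divided out.
        have := hj3 s
        rw [Fin.val_castSucc, mul_ite, mul_zero, ← pow_succ',
          show n + 1 - i + s - j s = n - i + s - j s + 1 by omega]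
    -- For `i = 0` the degree is zero, incompatible with a final 1.
    · obtain ⟨i, rfl⟩ : ∃ k, i = k + 1 := by
        refine Nat.exists_eq_succ_of_ne_zero ?_
        rintro rfl
        rw [Nat.sub_zero, h1, one_mul, add_mul] at hdeg
        have : 0 < (m + 1) ^ n * m := Nat.mul_pos hposn (by omega)
        omega
      have hdeg' : (∑ t : Fin n, J t.castSucc * (m + 1) ^ (t : ℕ)) * m + (m + 1) ^ (n - i) =
          (m + 1) ^ n := by
        rw [h1, one_mul, add_mul, Nat.add_sub_add_right, pow_succ] at hdeg
        linarith
      rw [h1, List.append_assoc] at hne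
      obtain ⟨j, hj1, hj2, hj3, hj4⟩ := ih i (by omega) _ hdeg' _ _ hne
      -- The removed position `n` becomes the largest index; its exponent is `p^(n-i+i-n) = 1`.
      refine ⟨Fin.snoc (α := fun _ => ℕ) j n, ?_, ?_, ?_, fun t => ?_⟩
      · intro a b hab
        induction b using Fin.lastCases with
        | last =>
          induction a using Fin.lastCases with
          | last => exact absurd hab (lt_irrefl _)
          | cast a => simpa using hj2 a
        | cast b =>
          induction a using Fin.lastCases with
          | last => exact absurd hab (not_lt.2 (Fin.castSucc_lt_last b).le)
          | cast a => simpa using hj1 (by simpa using hab)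
      · intro s
        induction s using Fin.lastCases with
        | last => simp
        | cast s => simpa using (hj2 s).trans (Nat.lt_succ_self n)
      · intro s
        induction s using Fin.lastCases with
        | last => simp; omega
        | cast s => simpa using hj3 s
      · rw [Fin.sum_univ_castSucc]
        simp only [Fin.snoc_castSucc, Fin.snoc_last, Fin.val_castSucc, Fin.val_last,
          Nat.add_sub_add_right]
        induction t using Fin.lastCases with
        | last =>
          rw [h1, Finset.sum_eq_zero, Fin.val_last, if_pos rfl, zero_add,
            show n - i + i - n = 0 by omega, pow_zero]
          exact fun s _ => if_neg (by have := hj2 s; simp; omega)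
        | cast t =>
          rw [hj4, Fin.val_castSucc, if_neg t.isLt.ne', add_zero]

end Combinatorics

/-! ### The support of the expansion of a Dickson invariant -/

/-- The exponent of the summand of the expansion of `d_{n,n-i}` with indices `j`. -/
noncomputable def dicksonExponent (p : ℕ) {n i : ℕ} (j : Fin i → Fin n) : Fin n →₀ ℕ :=
  ∑ s : Fin i, Finsupp.single (j s) (p ^ (n - i + (s : ℕ) - (j s : ℕ)))

theorem dicksonExponent_apply (p : ℕ) {n i : ℕ} (j : Fin i → Fin n) (t : Fin n) :
    dicksonExponent p j t =
      ∑ s : Fin i, if j s = t then p ^ (n - i + (s : ℕ) - (j s : ℕ)) else 0 := by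
  simp [dicksonExponent, Finsupp.finsetSum_apply, Finsupp.single_apply]

theorem dicksonExponent_ne_zero_iff {p : ℕ} (hp : 0 < p) {n i : ℕ} (j : Fin i → Fin n)
    (t : Fin n) : dicksonExponent p j t ≠ 0 ↔ t ∈ Set.range j := by
  rw [dicksonExponent_apply, Ne, Finset.sum_eq_zero_iff]
  simp [hp.ne']

/-- The support of the exponent is the range of the index sequence, and a strictly increasing
sequence is determined by its range. This excludes cancellation modulo `p` in the expansion. -/
theorem dicksonExponent_inj {p : ℕ} (hp : 0 < p) {n i : ℕ} {j k : Fin i → Fin n}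
    (hj : StrictMono j) (hk : StrictMono k) (h : dicksonExponent p j = dicksonExponent p k) :
    j = k := by
  refine (StrictMono.range_inj hj hk).1 (Set.ext fun t => ?_)
  rw [← dicksonExponent_ne_zero_iff hp, ← dicksonExponent_ne_zero_iff hp, h]

theorem dicksonExpansion_eq_sum_monomial (p n i : ℕ) :
    dicksonExpansion p n i = open Classical in
      ∑ j : Fin i → Fin n with StrictMono j,
        MvPolynomial.monomial (dicksonExponent p j) (1 : ZMod p) := by
  rw [dicksonExpansion]
  refine Finset.sum_congr rfl fun j _ => ?_
  rw [dicksonExponent, MvPolynomial.monomial_sum_one]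
  exact Finset.prod_congr rfl fun s _ => MvPolynomial.X_pow_eq_monomial

theorem dicksonExponent_mem_support {p n i : ℕ} [hp : Fact p.Prime] {j : Fin i → Fin n}
    (hj : StrictMono j) : dicksonExponent p j ∈ (dicksonExpansion p n i).support := by
  classical
  rw [MvPolynomial.mem_support_iff, dicksonExpansion_eq_sum_monomial, MvPolynomial.coeff_sum,
    Finset.sum_eq_single j]
  · simp
  · intro k hk hne
    rw [MvPolynomial.coeff_monomial, if_neg]
    exact fun h => hne
      (dicksonExponent_inj hp.out.pos (Finset.mem_filter.1 hk).2 hj h)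
  · intro h
    exact absurd (Finset.mem_filter.2 ⟨Finset.mem_univ _, hj⟩) h

/-! ### Vanishing outside the support of the Dickson expansion -/

theorem degree_eq_of_hDegree_eq {p n i : ℕ} (hp : 2 ≤ p) {J : Fin n →₀ ℕ}
    (hdeg : hDegree p n J = degFactor p * (p ^ n - p ^ (n - i))) :
    (∑ t : Fin n, J t * p ^ (t : ℕ)) * (p - 1) + p ^ (n - i) = p ^ n := by
  have h : hDegree p n J = degFactor p * ((∑ t : Fin n, J t * p ^ (t : ℕ)) * (p - 1)) := by
    rw [hDegree, Finset.sum_mul, Finset.mul_sum]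
    exact Finset.sum_congr rfl fun t _ => by ring
  rw [h] at hdeg
  rw [Nat.eq_of_mul_eq_mul_left (degFactor_pos p) hdeg]
  exact Nat.sub_add_cancel (Nat.pow_le_pow_right (by omega) (Nat.sub_le _ _))

theorem rho_e_lowerWord_eq_zero (p : ℕ) [hp : Fact p.Prime] (n i : ℕ) (hin : i ≤ n)
    (J : Fin n →₀ ℕ)
    (hdeg : hDegree p n J = degFactor p * (p ^ n - p ^ (n - i)))
    (hJ : J ∉ (dicksonExpansion p n i).support) :
    rho p (e (lowerWord p (List.ofFn J))) = 0 := by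
  by_contra hne
  obtain ⟨j, hj1, hj2, -, hj4⟩ := exists_strictMono_of_ne_zero
    (E := fun L => rho p (e (lowerWord p L))) hp.out.two_le (rho_e_lower_append_zero p) n i hin J
    (degree_eq_of_hDegree_eq hp.out.two_le hdeg) [] [] (by simpa using hne)
  have hmono : StrictMono fun s => (⟨j s, hj2 s⟩ : Fin n) := fun a b hab => hj1 hab
  have hJ' : J = dicksonExponent p fun s => (⟨j s, hj2 s⟩ : Fin n) := by
    ext t
    rw [dicksonExponent_apply, hj4]
    simp only [Fin.ext_iff]
  exact hJ (hJ' ▸ dicksonExponent_mem_support hmono)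

end DyerLashof

theorem mainTheorem5 (p : ℕ) [Fact p.Prime] (n i : ℕ) (hi : 1 ≤ i) (hin : i ≤ n)
    (J : Fin n →₀ ℕ)
    (hdeg : hDegree p n J = degFactor p * (p ^ n - p ^ (n - i)))
    (hJ : J ∉ (dicksonExpansion p n i).support)
    (I : List (Gen p)) (hlen : I.length = n) (hexc : NonnegExc I)
    (hdual : homDual I = hMonomial p n J) :
    rhoN p n (eN I hlen) = 0 := by
  apply Subtype.ext
  change rho p (e I) = 0
  rw [eq_lowerWord_of_homDual_eq hexc hdual]
  exact rho_e_lowerWord_eq_zero p n i hin J hdeg hJ
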